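/- There is an absolute constant $A>0$ with the following property. Let $2/3<\alpha\le 1$, $2/3<\beta\le 1$, $B\ge 0$, $C_1\in\mathbb R$ and $C_2\ge 1$, and let $\mu$ be a Borel probability measure on $\mathbb R$ supported on $[0,1]$, with Fourier coefficients $\widehat\mu(k)=\int_0^1 e^{-2\pi i kx}\,d\mu(x)$, such that (A) $\mu([x,x+\epsilon])\le C_1\epsilon^{\alpha}$ for all $x\in\mathbb R$ and $0<\epsilon\le 1$, (B) $|\widehat\mu(k)|\le C_2(1-\alpha)^{-B}|k|^{-\beta/2}$ for all integers $k\ne 0$ (for $\alpha=1$ the factor $(1-\alpha)^{-B}$ is read as $1$ if $B=0$ and as $+\infty$ if $B>0$, so that (B) is then no condition). Put $$p=\frac{2(\beta+4(1-\alpha))}{\beta+8(1-\alpha)},\qquad \theta=\frac2p-1 .$$ Then $$\Big(\int |f|^2\,d\mu\Big)^{1/2}\le 2^{6B}A\,C_2^{\theta}C_1^{1-\theta}\,\|\widehat f\|_{\ell^p(\mathbb Z)}$$ for every continuous $f:[0,1]\to\mathbb C$ whose sequence of Fourier coefficients $\widehat f(k)=\int_0^1 f(x)e^{-2\pi ikx}\,dx$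 lies in $\ell^p(\mathbb Z)$. Moreover, for every $c\in\ell^p(\mathbb Z)$ the series $\sum_{k\in\mathbb Z}c_k e^{2\pi ikx}$ converges unconditionally in $L^2(\mu)$, and its sum $f$ satisfies the same inequality with $c$ in place of $\widehat f$. -/

import Mathlib

open MeasureTheory Filter Topology

noncomputable section

/-- The Fourier coefficient `∫_0^1 e^{-2π i k x} dμ(x)` of a measure on the unit interval. -/
def measureFourierCoeff (μ : Measure ℝ) (k : ℤ) : ℂ :=
  ∫ x in Set.Icc (0 : ℝ) 1, Complex.exp (-(2 * Real.pi * Complex.I * k * x)) ∂μ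

/-- The ball condition `μ([x, x + ε]) ≤ C₁ ε ^ α` for all `x` and all `0 < ε ≤ 1`. -/
def BallCondition (μ : Measure ℝ) (α C₁ : ℝ) : Prop :=
  ∀ x ε : ℝ, 0 < ε → ε ≤ 1 → μ.real (Set.Icc x (x + ε)) ≤ C₁ * ε ^ α

/-- The Fourier decay `|μ̂(k)| ≤ C₂ (1 - α) ^ (-B) |k| ^ (-β / 2)` for all `k ≠ 0`.
The factor `(1 - α) ^ (-B)` is written on the left-hand side, so that at `α = 1` the condition has
the right meaning: there `(1 - α) ^ (-B)` is `1` if `B = 0`, and `+∞` (no condition) if `B > 0`,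
whereas the real power `0 ^ (-B)` would be `0`. -/
def FourierDecay (μ : Measure ℝ) (α β B C₂ : ℝ) : Prop :=
  ∀ k : ℤ, k ≠ 0 →
    (1 - α) ^ B * ‖measureFourierCoeff μ k‖ ≤ C₂ * |(k : ℝ)| ^ (-(β / 2))

/-- The norm `(∑ |c k| ^ p) ^ (1 / p)` of a sequence in `ℓ^p(ℤ)`; it is used only for sequences
with `∑ |c k| ^ p < ∞`. -/
def ellNorm (p : ℝ) (c : ℤ → ℂ) : ℝ := (∑' k, ‖c k‖ ^ p) ^ (1 / p)

end

/-!
With `η = 1 - α` and `e_k(x) = e^{2π i k x}`, everything follows from the inequality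
`∫ |E|² dμ ≤ (2^{6B} A C₂^θ C₁^{1-θ} ‖c‖_p)²` for finite sums `E = ∑ c_k e_k`
(`integral_sq_norm_trigSum_le`). The point is that `A` stays bounded as `α → 1`.

Averaging the translates of `μ` over `[0, 1/N]` gives a measure with density at most `C₁ N^η`, which
is bounded by `2 C₁ N^η` as a quadratic form on `ℓ²`; the coefficients of the difference are at most
`7 K N^{-β/2}`, where `K = C₂ η^{-B}`, which bounds its quadratic form on `ℓ¹`
(`integral_sq_norm_trigSum_le_of_decay`). So, for every `N`,
`∫ |E|² dμ ≤ 2 C₁ N^η ∑ |c_k|² + 7 K N^{-β/2} (∑ |c_k|)²`.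
A dyadic decomposition of `c` would now lose a factor `1/η`. Instead let `∑ |c_k|^p ≤ 1`, so that
`|c_k| ≤ 1`, and cut `c` into blocks `2^{-(b+1)/η} ≤ |c_k| ≤ 2^{-b/η}`, `b = 0, 1, 2, …`. In the
bound only powers of order `η` of the sizes of the coefficients matter, so such a block is as good
as one with comparable coefficients; and since `p` lies below the critical exponent by an amount of
order `η`, a suitable `N` for the `b`-th block gives a bound that decays geometrically in `b` at a
rate independent of `η` (`integral_sq_norm_trigSum_le_of_block`). Summing over `b` loses only a
constant. For `α = 1` the measure has density at most `C₁` and `p = 2`.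

The convergence of infinite series in `L²(μ)` is Cauchy's criterion. The Fourier series of a
continuous `f` on `[0, 1]` need not converge to `f` pointwise, but that of the average of `f` over
`[x, x + h]` does, by Parseval's identity, and its coefficients are no larger than those of `f`. Two
applications of Fatou's lemma, in the partial sums and as `h → 0`, give the inequality for `f`.
-/

/-! ### Exponential sums -/

/-- The character `x ↦ e^{2π i k x}` of frequency `k`. -/
noncomputable def planeWave (k : ℤ) (x : ℝ) : ℂ :=
  Complex.exp (2 * Real.pi * Complex.I * k * x)

/-- The exponential sum `∑_{k ∈ s} c_k e^{2π i k x}`. -/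
noncomputable def trigSum (s : Finset ℤ) (c : ℤ → ℂ) (x : ℝ) : ℂ :=
  ∑ k ∈ s, c k * planeWave k x

lemma continuous_planeWave (k : ℤ) : Continuous (planeWave k) := by
  unfold planeWave; fun_prop

lemma continuous_trigSum (s : Finset ℤ) (c : ℤ → ℂ) : Continuous (trigSum s c) :=
  continuous_finsetSum _ fun k _ => continuous_const.mul (continuous_planeWave k)

lemma planeWave_eq_exp_I_mul (k : ℤ) (x : ℝ) :
    planeWave k x = Complex.exp (Complex.I * ((2 * Real.pi * k * x : ℝ) : ℂ)) := by
  unfold planeWave; congr 1; push_cast; ring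

@[simp] lemma norm_planeWave (k : ℤ) (x : ℝ) : ‖planeWave k x‖ = 1 := by
  rw [planeWave_eq_exp_I_mul, mul_comm, Complex.norm_exp_ofReal_mul_I]

lemma planeWave_add (k : ℤ) (x h : ℝ) :
    planeWave k (x + h) = planeWave k x * planeWave k h := by
  unfold planeWave; rw [← Complex.exp_add]; congr 1; push_cast; ring

@[simp] lemma planeWave_zero_left (x : ℝ) : planeWave 0 x = 1 := by simp [planeWave]

lemma conj_planeWave (k : ℤ) (x : ℝ) :
    (starRingEnd ℂ) (planeWave k x) = planeWave (-k) x := by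
  rw [planeWave_eq_exp_I_mul, planeWave_eq_exp_I_mul, ← Complex.exp_conj, map_mul, Complex.conj_I,
    Complex.conj_ofReal]
  congr 1
  push_cast; ring

lemma planeWave_sub_left (k l : ℤ) (x : ℝ) :
    planeWave (k - l) x = planeWave k x * (starRingEnd ℂ) (planeWave l x) := by
  rw [conj_planeWave]
  unfold planeWave; rw [← Complex.exp_add]; congr 1; push_cast; ring

lemma norm_planeWave_sub_one_le (k : ℤ) (h : ℝ) :
    ‖planeWave k h - 1‖ ≤ 2 * Real.pi * (|(k : ℝ)| * |h|) := by
  rw [planeWave_eq_exp_I_mul]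
  refine Real.norm_exp_I_mul_ofReal_sub_one_le.trans (le_of_eq ?_)
  rw [Real.norm_eq_abs, abs_mul, abs_mul, abs_of_pos Real.two_pi_pos]
  ring

lemma norm_planeWave_sub_one_le_two (k : ℤ) (h : ℝ) : ‖planeWave k h - 1‖ ≤ 2 := by
  refine (norm_sub_le _ _).trans ?_
  rw [norm_planeWave, norm_one]; norm_num

lemma norm_trigSum_le (s : Finset ℤ) (c : ℤ → ℂ) (x : ℝ) : ‖trigSum s c x‖ ≤ ∑ k ∈ s, ‖c k‖ := by
  refine (norm_sum_le _ _).trans (le_of_eq ?_)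
  simp

lemma sq_norm_trigSum (s : Finset ℤ) (c : ℤ → ℂ) (x : ℝ) :
    ((‖trigSum s c x‖ ^ 2 : ℝ) : ℂ) =
      ∑ k ∈ s, ∑ l ∈ s, c k * (starRingEnd ℂ) (c l) * planeWave (k - l) x := by
  push_cast
  rw [← Complex.mul_conj', trigSum, map_sum, Finset.sum_mul_sum]
  refine Finset.sum_congr rfl fun k _ => Finset.sum_congr rfl fun l _ => ?_
  rw [planeWave_sub_left, map_mul]; ring

lemma integral_planeWave_zero_two {k : ℤ} (hk : k ≠ 0) :
    ∫ x in (0 : ℝ)..2, planeWave k x = 0 := by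
  have h : (2 * Real.pi * Complex.I * k : ℂ) ≠ 0 := by
    simp [Real.pi_ne_zero, hk]
  unfold planeWave
  rw [integral_exp_mul_complex h]
  have : Complex.exp (2 * Real.pi * Complex.I * k * ((2 : ℝ) : ℂ)) = 1 := by
    rw [Complex.exp_eq_one_iff]
    exact ⟨2 * k, by push_cast; ring⟩
  rw [this]; simp

/-- Orthogonality of characters, over two periods. -/
lemma integral_sq_norm_trigSum (s : Finset ℤ) (c : ℤ → ℂ) :
    ∫ x in (0 : ℝ)..2, ‖trigSum s c x‖ ^ 2 = 2 * ∑ k ∈ s, ‖c k‖ ^ 2 := by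
  have hint : ∀ a : ℂ, ∀ k : ℤ, IntervalIntegrable (fun x => a * planeWave k x) volume 0 2 :=
    fun a k => (continuous_const.mul (continuous_planeWave k)).intervalIntegrable _ _
  apply Complex.ofReal_injective
  rw [← intervalIntegral.integral_ofReal]
  simp_rw [sq_norm_trigSum]
  have hint' : ∀ k ∈ s, IntervalIntegrable
      (fun x => ∑ l ∈ s, c k * (starRingEnd ℂ) (c l) * planeWave (k - l) x) volume 0 2 :=
    fun k _ => (continuous_finsetSum _ fun l _ => continuous_const.mul
      (continuous_planeWave _)).intervalIntegrable _ _
  rw [intervalIntegral.integral_finsetSum hint']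
  push_cast
  rw [Finset.mul_sum]
  refine Finset.sum_congr rfl fun k hk => ?_
  rw [intervalIntegral.integral_finsetSum fun l _ => hint _ _, Finset.sum_eq_single k]
  · simp [Complex.mul_conj', mul_comm]
  · intro l _ hl
    rw [intervalIntegral.integral_const_mul,
      integral_planeWave_zero_two (sub_ne_zero.2 (Ne.symm hl)), mul_zero]
  · exact fun h => absurd hk h

/-! ### Comparison of a measure with its averaged translates -/

/-- The average of the translates of `μ` by `h ∈ [0, δ]` has a density, bounded by the largest
`μ`-mass of an interval of length `δ`. -/
lemma lintegral_lintegral_translate_le {μ : Measure ℝ} [IsProbabilityMeasure μ] {δ M : ℝ}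
    (hμ : μ (Set.Icc (0 : ℝ) 1)ᶜ = 0) (hδ : δ ≤ 1)
    (hM : ∀ y : ℝ, μ.real (Set.Icc y (y + δ)) ≤ M) {g : ℝ → ENNReal} (hg : Measurable g) :
    ∫⁻ h in Set.Icc 0 δ, ∫⁻ x, g (x + h) ∂μ ≤
      ENNReal.ofReal M * ∫⁻ y in Set.Icc 0 2, g y := by
  have hS : MeasurableSet {q : ℝ × ℝ | q.1 ≤ q.2 ∧ q.2 ≤ q.1 + δ} :=
    (measurableSet_le measurable_fst measurable_snd).inter
      (measurableSet_le measurable_snd (measurable_fst.add_const δ))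
  calc ∫⁻ h in Set.Icc 0 δ, ∫⁻ x, g (x + h) ∂μ
      = ∫⁻ x, (∫⁻ h in Set.Icc 0 δ, g (x + h)) ∂μ := by
        refine lintegral_lintegral_swap (Measurable.aemeasurable ?_)
        exact hg.comp (measurable_snd.add measurable_fst)
    _ ≤ ∫⁻ x, (∫⁻ y in Set.Icc 0 2,
          {q : ℝ × ℝ | q.1 ≤ q.2 ∧ q.2 ≤ q.1 + δ}.indicator (fun q => g q.2) (x, y)) ∂μ := by
        have hae : ∀ᵐ x ∂μ, x ∈ Set.Icc (0 : ℝ) 1 := hμ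
        refine lintegral_mono_ae ?_
        filter_upwards [hae] with x hx
        have h1 : ∫⁻ h in Set.Icc 0 δ, g (x + h) = ∫⁻ y in Set.Icc x (x + δ), g y := by
          rw [← lintegral_indicator measurableSet_Icc, ← lintegral_indicator measurableSet_Icc,
            ← lintegral_add_left_eq_self ((Set.Icc x (x + δ)).indicator g) x]
          refine lintegral_congr fun h => ?_
          simp only [Set.indicator_apply, Set.mem_Icc]
          congr 1
          simp
        rw [h1, ← lintegral_indicator measurableSet_Icc, ← lintegral_indicator measurableSet_Icc]
        refine lintegral_mono fun y => ?_
        simp only [Set.indicator_apply, Set.mem_Icc, Set.mem_ofPred_eq]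
        split_ifs with h2 h3
        · exact le_rfl
        · exact absurd ⟨hx.1.trans h2.1, by linarith [h2.2, hx.2]⟩ h3
        · exact bot_le
        · exact bot_le
    _ = ∫⁻ y in Set.Icc 0 2, ∫⁻ x,
          {q : ℝ × ℝ | q.1 ≤ q.2 ∧ q.2 ≤ q.1 + δ}.indicator (fun q => g q.2) (x, y) ∂μ := by
        refine lintegral_lintegral_swap (Measurable.aemeasurable ?_)
        exact (hg.comp measurable_snd).indicator hS
    _ ≤ ∫⁻ y in Set.Icc 0 2, ENNReal.ofReal M * g y := by
        refine lintegral_mono fun y => ?_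
        calc ∫⁻ x, {q : ℝ × ℝ | q.1 ≤ q.2 ∧ q.2 ≤ q.1 + δ}.indicator (fun q => g q.2) (x, y) ∂μ
            = ∫⁻ x, (Set.Icc (y - δ) (y - δ + δ)).indicator (fun _ => g y) x ∂μ := by
              refine lintegral_congr fun x => ?_
              simp only [Set.indicator_apply, Set.mem_Icc, Set.mem_ofPred_eq]
              congr 1
              apply propext
              constructor
              · rintro ⟨h1, h2⟩; constructor <;> linarith
              · rintro ⟨h1, h2⟩; constructor <;> linarith
          _ = g y * μ (Set.Icc (y - δ) (y - δ + δ)) := by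
              rw [lintegral_indicator measurableSet_Icc, setLIntegral_const]
          _ ≤ ENNReal.ofReal M * g y := by
              rw [mul_comm]
              gcongr
              rw [← ofReal_measureReal]
              exact ENNReal.ofReal_le_ofReal (hM _)
    _ = ENNReal.ofReal M * ∫⁻ y in Set.Icc 0 2, g y := lintegral_const_mul _ hg

lemma integrable_sq_norm_trigSum {μ : Measure ℝ} [IsFiniteMeasure μ] (s : Finset ℤ) (c : ℤ → ℂ)
    (h : ℝ) : Integrable (fun x => ‖trigSum s c (x + h)‖ ^ 2) μ := by
  refine Integrable.of_bound (C := (∑ k ∈ s, ‖c k‖) ^ 2) ?_ (ae_of_all _ fun x => ?_)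
  · exact (((continuous_trigSum s c).comp
      (continuous_id.add continuous_const)).norm.pow 2).aestronglyMeasurable
  · rw [Real.norm_eq_abs, abs_of_nonneg (by positivity)]
    gcongr
    exact norm_trigSum_le s c _

lemma integral_planeWave_eq {μ : Measure ℝ} (hμ : μ (Set.Icc (0 : ℝ) 1)ᶜ = 0) (k : ℤ) :
    ∫ x, planeWave k x ∂μ = measureFourierCoeff μ (-k) := by
  unfold measureFourierCoeff planeWave
  rw [Measure.restrict_eq_self_of_ae_mem (show ∀ᵐ x ∂μ, x ∈ Set.Icc (0 : ℝ) 1 from hμ)]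
  congr 1; ext x; congr 1; push_cast; ring

lemma norm_measureFourierCoeff_le_one {μ : Measure ℝ} [IsProbabilityMeasure μ]
    (hμ : μ (Set.Icc (0 : ℝ) 1)ᶜ = 0) (k : ℤ) : ‖measureFourierCoeff μ k‖ ≤ 1 := by
  have h := integral_planeWave_eq hμ (-k)
  rw [neg_neg] at h
  rw [← h]
  refine (norm_integral_le_integral_norm _).trans ?_
  simp

/-- Translating `μ` by `h` changes the quadratic form of `μ` by the multiplier
`1 - e^{2π i (k - l) h}` on its coefficients. -/
lemma abs_integral_sub_integral_translate_le {μ : Measure ℝ} [IsProbabilityMeasure μ]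
    (hμ : μ (Set.Icc (0 : ℝ) 1)ᶜ = 0) (s : Finset ℤ) (c : ℤ → ℂ) {h W : ℝ}
    (hW : ∀ k ∈ s, ∀ l ∈ s,
      ‖planeWave (k - l) h - 1‖ * ‖measureFourierCoeff μ (-(k - l))‖ ≤ W) :
    ∫ x, ‖trigSum s c x‖ ^ 2 ∂μ ≤
      ∫ x, ‖trigSum s c (x + h)‖ ^ 2 ∂μ + W * (∑ k ∈ s, ‖c k‖) ^ 2 := by
  have hint : ∀ a : ℂ, ∀ k : ℤ, ∀ h : ℝ, Integrable (fun x => a * planeWave k (x + h)) μ := by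
    intro a k h
    refine Integrable.of_bound (C := ‖a‖) ?_ (ae_of_all _ fun x => by simp)
    exact (continuous_const.mul ((continuous_planeWave k).comp
      (continuous_id.add continuous_const))).aestronglyMeasurable
  have key : ∀ h : ℝ, ((∫ x, ‖trigSum s c (x + h)‖ ^ 2 ∂μ : ℝ) : ℂ) =
      ∑ k ∈ s, ∑ l ∈ s, c k * (starRingEnd ℂ) (c l) *
        (planeWave (k - l) h * measureFourierCoeff μ (-(k - l))) := by
    intro h
    rw [← integral_complex_ofReal]
    simp_rw [sq_norm_trigSum]
    rw [integral_finsetSum _ fun k _ => integrable_finsetSum _ fun l _ => hint _ _ _]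
    refine Finset.sum_congr rfl fun k _ => ?_
    rw [integral_finsetSum _ fun l _ => hint _ _ _]
    refine Finset.sum_congr rfl fun l _ => ?_
    rw [integral_const_mul]
    simp_rw [planeWave_add]
    rw [integral_mul_const, integral_planeWave_eq hμ, mul_comm (measureFourierCoeff μ _)]
  have h0 := key 0
  simp only [add_zero] at h0
  have hsub : ((∫ x, ‖trigSum s c (x + h)‖ ^ 2 ∂μ - ∫ x, ‖trigSum s c x‖ ^ 2 ∂μ : ℝ) : ℂ) =
      ∑ k ∈ s, ∑ l ∈ s, c k * (starRingEnd ℂ) (c l) *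
        ((planeWave (k - l) h - 1) * measureFourierCoeff μ (-(k - l))) := by
    rw [Complex.ofReal_sub, key, h0, ← Finset.sum_sub_distrib]
    refine Finset.sum_congr rfl fun k _ => ?_
    rw [← Finset.sum_sub_distrib]
    refine Finset.sum_congr rfl fun l _ => ?_
    simp [planeWave]
    ring
  have hn : |∫ x, ‖trigSum s c (x + h)‖ ^ 2 ∂μ - ∫ x, ‖trigSum s c x‖ ^ 2 ∂μ| ≤
      W * (∑ k ∈ s, ‖c k‖) ^ 2 := by
    rw [← Real.norm_eq_abs, ← Complex.norm_real, hsub]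
    calc _ ≤ ∑ k ∈ s, ∑ l ∈ s, ‖c k‖ * ‖c l‖ * W := by
          refine norm_sum_le_of_le _ fun k hk => norm_sum_le_of_le _ fun l hl => ?_
          rw [norm_mul, norm_mul, norm_mul, RCLike.norm_conj]
          exact mul_le_mul_of_nonneg_left (hW k hk l hl) (by positivity)
      _ = _ := by
          rw [sq, Finset.sum_mul_sum, Finset.mul_sum]
          refine Finset.sum_congr rfl fun k _ => ?_
          rw [Finset.mul_sum]
          exact Finset.sum_congr rfl fun l _ => mul_comm _ _
  linarith [neg_abs_le (∫ x, ‖trigSum s c (x + h)‖ ^ 2 ∂μ - ∫ x, ‖trigSum s c x‖ ^ 2 ∂μ)]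

/-- Splitting of the quadratic form of `μ` at scale `δ`: the averaged measure is bounded on
`ℓ²` by its density, the difference is bounded from `ℓ¹` to `ℓ^∞` by its coefficients. -/
lemma integral_sq_norm_trigSum_le_of_scale {μ : Measure ℝ} [IsProbabilityMeasure μ]
    (hμ : μ (Set.Icc (0 : ℝ) 1)ᶜ = 0) (s : Finset ℤ) (c : ℤ → ℂ) {δ M W : ℝ}
    (hδ0 : 0 < δ) (hδ : δ ≤ 1) (hM : ∀ y : ℝ, μ.real (Set.Icc y (y + δ)) ≤ M) (hW0 : 0 ≤ W)
    (hW : ∀ k ∈ s, ∀ l ∈ s, ∀ h ∈ Set.Icc 0 δ,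
      ‖planeWave (k - l) h - 1‖ * ‖measureFourierCoeff μ (-(k - l))‖ ≤ W) :
    ∫ x, ‖trigSum s c x‖ ^ 2 ∂μ ≤
      2 * (M / δ) * ∑ k ∈ s, ‖c k‖ ^ 2 + W * (∑ k ∈ s, ‖c k‖) ^ 2 := by
  set X := ∫ x, ‖trigSum s c x‖ ^ 2 ∂μ with hX
  set Y := W * (∑ k ∈ s, ‖c k‖) ^ 2 with hY
  have hY0 : 0 ≤ Y := by positivity
  have hM0 : 0 ≤ M := measureReal_nonneg.trans (hM 0)
  have h1 : ∀ h ∈ Set.Icc 0 δ, ENNReal.ofReal X ≤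
      ∫⁻ x, ENNReal.ofReal (‖trigSum s c (x + h)‖ ^ 2) ∂μ + ENNReal.ofReal Y := by
    intro h hh
    rw [← ofReal_integral_eq_lintegral_ofReal (integrable_sq_norm_trigSum s c h)
      (ae_of_all _ fun x => by positivity), ← ENNReal.ofReal_add (by positivity) hY0]
    exact ENNReal.ofReal_le_ofReal
      (abs_integral_sub_integral_translate_le hμ s c fun k hk l hl => hW k hk l hl h hh)
  have hmeas : Measurable fun x => ENNReal.ofReal (‖trigSum s c x‖ ^ 2) :=
    (((continuous_trigSum s c).norm.pow 2).measurable).ennreal_ofReal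
  have h2 : ENNReal.ofReal X * ENNReal.ofReal δ ≤
      ENNReal.ofReal M * ENNReal.ofReal (2 * ∑ k ∈ s, ‖c k‖ ^ 2) +
        ENNReal.ofReal Y * ENNReal.ofReal δ := by
    have hvol : volume (Set.Icc 0 δ) = ENNReal.ofReal δ := by simp
    calc ENNReal.ofReal X * ENNReal.ofReal δ
        = ∫⁻ _ in Set.Icc 0 δ, ENNReal.ofReal X := by rw [setLIntegral_const, hvol]
      _ ≤ ∫⁻ h in Set.Icc 0 δ,
            (∫⁻ x, ENNReal.ofReal (‖trigSum s c (x + h)‖ ^ 2) ∂μ + ENNReal.ofReal Y) :=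
          setLIntegral_mono' measurableSet_Icc h1
      _ = (∫⁻ h in Set.Icc 0 δ, ∫⁻ x, ENNReal.ofReal (‖trigSum s c (x + h)‖ ^ 2) ∂μ) +
            ENNReal.ofReal Y * ENNReal.ofReal δ := by
          rw [lintegral_add_right _ measurable_const, setLIntegral_const, hvol]
      _ ≤ _ := by
          gcongr
          refine (lintegral_lintegral_translate_le hμ hδ hM hmeas).trans (le_of_eq ?_)
          congr 1
          rw [← integral_sq_norm_trigSum, intervalIntegral.integral_of_le zero_le_two,
            ← integral_Icc_eq_integral_Ioc]
          have hi : IntegrableOn (fun x => ‖trigSum s c x‖ ^ 2) (Set.Icc 0 2) :=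
            ((continuous_trigSum s c).norm.pow 2).continuousOn.integrableOn_Icc
          exact (ofReal_integral_eq_lintegral_ofReal hi (ae_of_all _ fun x => by positivity)).symm
  have hS0 : 0 ≤ ∑ k ∈ s, ‖c k‖ ^ 2 := by positivity
  rw [← ENNReal.ofReal_mul (by positivity), ← ENNReal.ofReal_mul hM0, ← ENNReal.ofReal_mul hY0,
    ← ENNReal.ofReal_add (by positivity) (by positivity),
    ENNReal.ofReal_le_ofReal_iff (by positivity)] at h2
  rw [← mul_le_mul_iff_left₀ hδ0]
  refine h2.trans (le_of_eq ?_)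
  field_simp

/-! ### Estimates for exponential sums with few terms -/

/-- The trade-off between the `ℓ²` and `ℓ¹` bounds at scale `N`. For `N ≤ 1` the bound is the
triangle inequality, so that `N` can later be chosen without constraint. -/
lemma integral_sq_norm_trigSum_le_of_decay {μ : Measure ℝ} [IsProbabilityMeasure μ]
    (hμ : μ (Set.Icc (0 : ℝ) 1)ᶜ = 0) {α β C₁ K : ℝ} (hC₁ : 0 ≤ C₁) (hball : BallCondition μ α C₁)
    (hβ0 : 0 ≤ β) (hβ1 : β ≤ 1) (hK : 1 ≤ K)
    (hdecay : ∀ k : ℤ, k ≠ 0 → ‖measureFourierCoeff μ k‖ ≤ K * |(k : ℝ)| ^ (-(β / 2)))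
    (s : Finset ℤ) (c : ℤ → ℂ) {N : ℝ} (hN : 0 < N) :
    ∫ x, ‖trigSum s c x‖ ^ 2 ∂μ ≤
      2 * (C₁ * N ^ (1 - α)) * ∑ k ∈ s, ‖c k‖ ^ 2 +
        7 * (K * N ^ (-(β / 2))) * (∑ k ∈ s, ‖c k‖) ^ 2 := by
  have hpi : 2 * Real.pi ≤ 7 := by linarith [Real.pi_lt_d2]
  rcases le_total N 1 with hN1 | hN1
  · have h1 : ∫ x, ‖trigSum s c x‖ ^ 2 ∂μ ≤ (∑ k ∈ s, ‖c k‖) ^ 2 := by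
      have := integral_mono_of_nonneg (μ := μ) (f := fun x => ‖trigSum s c x‖ ^ 2)
        (g := fun _ => (∑ k ∈ s, ‖c k‖) ^ 2) (ae_of_all _ fun x => by positivity)
        (integrable_const _) (ae_of_all _ fun x => by
          have := norm_trigSum_le s c x
          dsimp only
          gcongr)
      simpa using this
    have h2 : (1 : ℝ) ≤ N ^ (-(β / 2)) :=
      Real.one_le_rpow_of_pos_of_le_one_of_nonpos hN hN1 (by linarith)
    have h3 : 1 ≤ 7 * (K * N ^ (-(β / 2))) := by nlinarith
    have h4 : 0 ≤ 2 * (C₁ * N ^ (1 - α)) * ∑ k ∈ s, ‖c k‖ ^ 2 := by positivity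
    have h5 : 0 ≤ (∑ k ∈ s, ‖c k‖) ^ 2 := by positivity
    nlinarith
  · have hM : ∀ y : ℝ, μ.real (Set.Icc y (y + N⁻¹)) ≤ C₁ * N⁻¹ ^ α := fun y =>
      hball y _ (by positivity) (inv_le_one_of_one_le₀ hN1)
    have hW : ∀ k ∈ s, ∀ l ∈ s, ∀ h ∈ Set.Icc 0 N⁻¹,
        ‖planeWave (k - l) h - 1‖ * ‖measureFourierCoeff μ (-(k - l))‖ ≤
          7 * (K * N ^ (-(β / 2))) := by
      intro k _ l _ h hh
      rcases eq_or_ne (k - l) 0 with h0 | h0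
      · rw [h0]; simp; positivity
      set n : ℝ := |((k - l : ℤ) : ℝ)| with hn
      have hn0 : 0 < n := abs_pos.2 (Int.cast_ne_zero.2 h0)
      have hd := hdecay (-(k - l)) (neg_ne_zero.2 h0)
      rw [Int.cast_neg, abs_neg, ← hn] at hd
      have h1 : ‖planeWave (k - l) h - 1‖ ≤ 7 * (n / N) ^ (β / 2) := by
        rcases le_total 1 (n / N) with ht | ht
        · have := Real.one_le_rpow ht (by linarith : 0 ≤ β / 2)
          linarith [norm_planeWave_sub_one_le_two (k - l) h]
        · have h2 := norm_planeWave_sub_one_le (k - l) h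
          have h3 : n * |h| ≤ n / N := by
            rw [abs_of_nonneg hh.1, div_eq_mul_inv]
            exact mul_le_mul_of_nonneg_left hh.2 hn0.le
          have h4 : n / N ≤ (n / N) ^ (β / 2) :=
            Real.self_le_rpow_of_le_one (by positivity) ht (by linarith)
          rw [← hn] at h2
          have h5 : 0 ≤ n * |h| := by positivity
          nlinarith
      calc _ ≤ (7 * (n / N) ^ (β / 2)) * (K * n ^ (-(β / 2))) := by gcongr
        _ = _ := by
          rw [Real.div_rpow hn0.le hN.le, Real.rpow_neg hn0.le, Real.rpow_neg hN.le]
          have := Real.rpow_pos_of_pos hn0 (β / 2)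
          field_simp
    refine (integral_sq_norm_trigSum_le_of_scale hμ s c (inv_pos.2 hN)
      (inv_le_one_of_one_le₀ hN1) hM (by positivity) hW).trans (le_of_eq ?_)
    rw [Real.inv_rpow hN.le, Real.rpow_sub hN, Real.rpow_one]
    field_simp

/-- For `α = 1` the measure has a bounded density, and only the ball condition is needed. -/
lemma integral_sq_norm_trigSum_le_of_ball_one {μ : Measure ℝ} [IsProbabilityMeasure μ]
    (hμ : μ (Set.Icc (0 : ℝ) 1)ᶜ = 0) {C₁ : ℝ} (hball : BallCondition μ 1 C₁)
    (s : Finset ℤ) (c : ℤ → ℂ) :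
    ∫ x, ‖trigSum s c x‖ ^ 2 ∂μ ≤ 2 * C₁ * ∑ k ∈ s, ‖c k‖ ^ 2 := by
  obtain ⟨D, hD0, hD⟩ : ∃ D : ℝ, 0 ≤ D ∧ ∀ k ∈ s, ∀ l ∈ s, |((k - l : ℤ) : ℝ)| ≤ D := by
    refine ⟨∑ k ∈ s, ∑ l ∈ s, |((k - l : ℤ) : ℝ)|, by positivity, fun k hk l hl => ?_⟩
    refine le_trans ?_ (Finset.single_le_sum (f := fun k => ∑ l ∈ s, |((k - l : ℤ) : ℝ)|)
      (fun i _ => by positivity) hk)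
    exact Finset.single_le_sum (f := fun l => |((k - l : ℤ) : ℝ)|) (fun i _ => by positivity) hl
  have key : ∀ δ : ℝ, 0 < δ → δ ≤ 1 → ∫ x, ‖trigSum s c x‖ ^ 2 ∂μ ≤
      2 * C₁ * ∑ k ∈ s, ‖c k‖ ^ 2 + (2 * Real.pi * (D * δ)) * (∑ k ∈ s, ‖c k‖) ^ 2 := by
    intro δ hδ0 hδ1
    have h := integral_sq_norm_trigSum_le_of_scale hμ s c hδ0 hδ1 (fun y => hball y δ hδ0 hδ1)
      (W := 2 * Real.pi * (D * δ)) (by positivity) (fun k hk l hl h hh => by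
        calc _ ≤ (2 * Real.pi * (|((k - l : ℤ) : ℝ)| * |h|)) * 1 := by
              gcongr
              · exact norm_planeWave_sub_one_le _ _
              · exact norm_measureFourierCoeff_le_one hμ _
          _ ≤ _ := by
              rw [mul_one, abs_of_nonneg hh.1]
              gcongr
              · exact hh.1
              · exact hD k hk l hl
              · exact hh.2)
    rwa [Real.rpow_one, mul_div_assoc, div_self hδ0.ne', mul_one] at h
  have hlim : Tendsto (fun δ : ℝ => 2 * C₁ * ∑ k ∈ s, ‖c k‖ ^ 2 +
      (2 * Real.pi * (D * δ)) * (∑ k ∈ s, ‖c k‖) ^ 2) (𝓝[>] 0)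
      (𝓝 (2 * C₁ * ∑ k ∈ s, ‖c k‖ ^ 2)) := by
    have : Continuous fun δ : ℝ => 2 * C₁ * ∑ k ∈ s, ‖c k‖ ^ 2 +
      (2 * Real.pi * (D * δ)) * (∑ k ∈ s, ‖c k‖) ^ 2 := by fun_prop
    simpa using (this.tendsto 0).mono_left nhdsWithin_le_nhds
  refine ge_of_tendsto hlim ?_
  filter_upwards [Ioc_mem_nhdsGT (zero_lt_one' ℝ)] with δ hδ using key δ hδ.1 hδ.2

/-! ### Summation over blocks of coefficients of comparable size -/

/-- The estimate for coefficients in one block `[2^{-(b+1)/η}, 2^{-b/η}]`, where `η = 1 - α`. The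
ratio `2^{1/η}` of the block is as large as possible such that its `η`-th power stays bounded, and
the resulting bound decays geometrically in `b`, at a rate independent of `η`. -/
lemma integral_sq_norm_trigSum_le_of_block {μ : Measure ℝ} [IsProbabilityMeasure μ]
    (hμ : μ (Set.Icc (0 : ℝ) 1)ᶜ = 0) {η β C₁ K p : ℝ} (hC₁ : 1 ≤ C₁)
    (hball : BallCondition μ (1 - η) C₁) (hη0 : 0 < η) (hη : η < 1 / 3)
    (hβ0 : 2 / 3 < β) (hβ1 : β ≤ 1) (hK : 1 ≤ K)
    (hdecay : ∀ k : ℤ, k ≠ 0 → ‖measureFourierCoeff μ k‖ ≤ K * |(k : ℝ)| ^ (-(β / 2)))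
    (hp : p = 2 * (β + 4 * η) / (β + 8 * η))
    (s : Finset ℤ) (c : ℤ → ℂ) (b : ℕ)
    (hlow : ∀ k ∈ s, (2 : ℝ) ^ (-((b + 1) / η)) ≤ ‖c k‖)
    (hup : ∀ k ∈ s, ‖c k‖ ≤ (2 : ℝ) ^ (-(b / η)))
    (hsum : ∑ k ∈ s, ‖c k‖ ^ p ≤ 1) :
    ∫ x, ‖trigSum s c x‖ ^ 2 ∂μ ≤
      1031 * (C₁ * (K / C₁) ^ (η / (η + β / 2))) * ((9 / 10 : ℝ) ^ b) ^ 2 := by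
  have hb : (0 : ℝ) ≤ b := Nat.cast_nonneg b
  set D := β + 8 * η with hD
  have hD0 : 0 < D := by positivity
  have hD1 : 2 / 3 < D := by linarith
  have hD2 : D < 11 / 3 := by linarith
  have hpos : ∀ k ∈ s, 0 < ‖c k‖ := fun k hk =>
    (Real.rpow_pos_of_pos two_pos _).trans_le (hlow k hk)
  have hp2 : 2 - p = 8 * η / D := by rw [hp]; field_simp; ring
  have hp1 : p - 1 = β / D := by rw [hp]; field_simp; ring
  have hS2 : ∑ k ∈ s, ‖c k‖ ^ 2 ≤ (2 : ℝ) ^ (-(8 * b / D)) := by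
    calc ∑ k ∈ s, ‖c k‖ ^ 2 ≤ ∑ k ∈ s, ‖c k‖ ^ p * (2 : ℝ) ^ (-(8 * b / D)) := by
          refine Finset.sum_le_sum fun k hk => ?_
          have h1 : ‖c k‖ ^ 2 = ‖c k‖ ^ p * ‖c k‖ ^ (2 - p) := by
            rw [← Real.rpow_add (hpos k hk), ← Real.rpow_natCast]; congr 1; push_cast; ring
          rw [h1, hp2]
          gcongr
          calc ‖c k‖ ^ (8 * η / D) ≤ ((2 : ℝ) ^ (-(b / η))) ^ (8 * η / D) := by
                gcongr
                exact hup k hk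
            _ = _ := by
                rw [← Real.rpow_mul zero_le_two]; congr 1; field_simp
      _ ≤ _ := by
          rw [← Finset.sum_mul]
          exact mul_le_of_le_one_left (by positivity) hsum
  have hS1 : ∑ k ∈ s, ‖c k‖ ≤ (2 : ℝ) ^ ((b + 1) * β / (η * D)) := by
    calc ∑ k ∈ s, ‖c k‖ ≤ ∑ k ∈ s, ‖c k‖ ^ p * (2 : ℝ) ^ ((b + 1) * β / (η * D)) := by
          refine Finset.sum_le_sum fun k hk => ?_
          have h1 : ‖c k‖ = ‖c k‖ ^ p * ‖c k‖ ^ (-(p - 1)) := by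
            rw [← Real.rpow_add (hpos k hk)]
            conv_lhs => rw [← Real.rpow_one ‖c k‖]
            congr 1; ring
          rw [hp1] at h1
          refine h1.le.trans ?_
          gcongr
          calc ‖c k‖ ^ (-(β / D)) ≤ ((2 : ℝ) ^ (-((b + 1) / η))) ^ (-(β / D)) := by
                exact Real.rpow_le_rpow_of_nonpos (by positivity) (hlow k hk)
                  (by have : 0 < β / D := by positivity
                      linarith)
            _ = _ := by
                rw [← Real.rpow_mul zero_le_two]; congr 1; field_simp
      _ ≤ _ := by
          rw [← Finset.sum_mul]
          exact mul_le_of_le_one_left (by positivity) hsum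
  -- At the scale `M` the two bounds balance for `C₁` and `K`; the power of `2` in `N` lies between
  -- the exponents at which either bound would stop to decay in `b`.
  set M := (K / C₁) ^ (1 / (η + β / 2)) with hM
  have hKC : 0 < K / C₁ := by positivity
  have hM0 : 0 < M := Real.rpow_pos_of_pos hKC _
  set Q := C₁ * (K / C₁) ^ (η / (η + β / 2)) with hQ
  have hQ0 : 0 < Q := by positivity
  have hQ1 : C₁ * M ^ η = Q := by
    rw [hM, ← Real.rpow_mul hKC.le, hQ]; congr 2; ring
  have hQ2 : K * M ^ (-(β / 2)) = Q := by
    have : η / (η + β / 2) = 1 + 1 / (η + β / 2) * (-(β / 2)) := by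
      field_simp; ring
    rw [hM, ← Real.rpow_mul hKC.le, hQ, this, Real.rpow_add hKC, Real.rpow_one]
    field_simp
  set N := M * (2 : ℝ) ^ (6 * (b + 1) / (D * η)) with hN
  have hN0 : 0 < N := by positivity
  have hN1 : C₁ * N ^ η = Q * (2 : ℝ) ^ (6 * (b + 1) / D) := by
    rw [hN, Real.mul_rpow hM0.le (by positivity), ← mul_assoc, hQ1, ← Real.rpow_mul zero_le_two]
    congr 2; field_simp
  have hN2 : K * N ^ (-(β / 2)) = Q * (2 : ℝ) ^ (-(3 * β * (b + 1) / (D * η))) := by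
    rw [hN, Real.mul_rpow hM0.le (by positivity), ← mul_assoc, hQ2, ← Real.rpow_mul zero_le_two]
    congr 2; field_simp; norm_num
  have hmain := integral_sq_norm_trigSum_le_of_decay hμ (by linarith) hball (by linarith) hβ1 hK
    hdecay s c hN0
  rw [sub_sub_cancel, hN1, hN2] at hmain
  have hgeo : (2 : ℝ) ^ (-(b / 2 : ℝ)) ≤ ((9 / 10 : ℝ) ^ b) ^ 2 := by
    have h1 : (2 : ℝ) ^ (-(1 / 2 : ℝ)) ≤ (9 / 10) ^ 2 := by
      rw [Real.rpow_neg zero_le_two, ← Real.sqrt_eq_rpow]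
      have : (10 / 9 : ℝ) ^ 2 ≤ √2 := Real.le_sqrt_of_sq_le (by norm_num)
      calc (√2)⁻¹ ≤ ((10 / 9 : ℝ) ^ 2)⁻¹ := by gcongr
        _ = _ := by norm_num
    calc (2 : ℝ) ^ (-(b / 2 : ℝ)) = ((2 : ℝ) ^ (-(1 / 2 : ℝ))) ^ b := by
          rw [← Real.rpow_natCast, ← Real.rpow_mul zero_le_two]; congr 1; ring
      _ ≤ ((9 / 10) ^ 2) ^ b := by gcongr
      _ = _ := by rw [← pow_mul, ← pow_mul, mul_comm]
  have hT1 : (2 : ℝ) ^ (6 * (b + 1) / D) * (2 : ℝ) ^ (-(8 * b / D)) ≤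
      512 * (2 : ℝ) ^ (-(b / 2 : ℝ)) := by
    have h512 : (512 : ℝ) = (2 : ℝ) ^ (9 : ℝ) := by norm_num
    rw [h512, ← Real.rpow_add two_pos, ← Real.rpow_add two_pos]
    refine Real.rpow_le_rpow_of_exponent_le one_le_two ?_
    have h1 : 6 * (b + 1 : ℝ) / D + -(8 * b / D) = (6 - 2 * b) / D := by ring
    rw [h1, div_le_iff₀ hD0]
    nlinarith
  have hT2 : (2 : ℝ) ^ (-(3 * β * (b + 1) / (D * η))) * ((2 : ℝ) ^ ((b + 1) * β / (η * D))) ^ 2 ≤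
      (2 : ℝ) ^ (-(b / 2 : ℝ)) := by
    rw [← Real.rpow_natCast, ← Real.rpow_mul zero_le_two, ← Real.rpow_add two_pos]
    refine Real.rpow_le_rpow_of_exponent_le one_le_two ?_
    have h1 : -(3 * β * (b + 1 : ℝ) / (D * η)) + (b + 1) * β / (η * D) * (2 : ℕ) =
        -((β / η) * (b + 1) / D) := by
      push_cast; field_simp; ring
    rw [h1, neg_le_neg_iff, le_div_iff₀ hD0]
    have h2 : 2 ≤ β / η := by rw [le_div_iff₀ hη0]; linarith
    nlinarith
  calc ∫ x, ‖trigSum s c x‖ ^ 2 ∂μ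
      ≤ 2 * (Q * (2 : ℝ) ^ (6 * (b + 1) / D)) * (2 : ℝ) ^ (-(8 * b / D)) +
        7 * (Q * (2 : ℝ) ^ (-(3 * β * (b + 1) / (D * η)))) *
          ((2 : ℝ) ^ ((b + 1) * β / (η * D))) ^ 2 := by
        refine hmain.trans ?_
        gcongr
    _ = Q * (2 * ((2 : ℝ) ^ (6 * (b + 1) / D) * (2 : ℝ) ^ (-(8 * b / D))) +
        7 * ((2 : ℝ) ^ (-(3 * β * (b + 1) / (D * η))) *
          ((2 : ℝ) ^ ((b + 1) * β / (η * D))) ^ 2)) := by ring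
    _ ≤ Q * (1031 * ((9 / 10 : ℝ) ^ b) ^ 2) := by
        gcongr
        linarith
    _ = _ := by ring

lemma sum_pow_nine_tenths_le (t : Finset ℕ) : ∑ b ∈ t, (9 / 10 : ℝ) ^ b ≤ 10 := by
  have h := (summable_geometric_of_lt_one (by norm_num : (0 : ℝ) ≤ 9 / 10)
    (by norm_num)).sum_le_tsum t fun i _ => by positivity
  rw [tsum_geometric_of_lt_one (by norm_num) (by norm_num)] at h
  norm_num at h ⊢
  exact h

/-- Since the bounds for the blocks decay geometrically, the blocks can be summed by the
Cauchy–Schwarz inequality, without any orthogonality between them. -/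
lemma integral_sq_norm_trigSum_le_of_sum_le_one {μ : Measure ℝ} [IsProbabilityMeasure μ]
    (hμ : μ (Set.Icc (0 : ℝ) 1)ᶜ = 0) {η β C₁ K p : ℝ} (hC₁ : 1 ≤ C₁)
    (hball : BallCondition μ (1 - η) C₁) (hη0 : 0 < η) (hη : η < 1 / 3)
    (hβ0 : 2 / 3 < β) (hβ1 : β ≤ 1) (hK : 1 ≤ K)
    (hdecay : ∀ k : ℤ, k ≠ 0 → ‖measureFourierCoeff μ k‖ ≤ K * |(k : ℝ)| ^ (-(β / 2)))
    (hp : p = 2 * (β + 4 * η) / (β + 8 * η))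
    (s : Finset ℤ) (c : ℤ → ℂ) (hsum : ∑ k ∈ s, ‖c k‖ ^ p ≤ 1) :
    ∫ x, ‖trigSum s c x‖ ^ 2 ∂μ ≤ 103100 * (C₁ * (K / C₁) ^ (η / (η + β / 2))) := by
  have hp0 : 0 < p := by rw [hp]; positivity
  set Q := C₁ * (K / C₁) ^ (η / (η + β / 2)) with hQ
  have hQ0 : 0 < Q := by positivity
  set v : ℤ → ℕ := fun k => ⌊-(η * Real.logb 2 ‖c k‖)⌋₊ with hv
  set s' := s.filter fun k => c k ≠ 0 with hs'
  set t := s'.image v with ht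
  set blk : ℕ → Finset ℤ := fun b => s'.filter fun k => v k = b with hblk
  have hdec : ∀ x, trigSum s c x = ∑ b ∈ t, trigSum (blk b) c x := by
    intro x
    have h1 : trigSum s c x = trigSum s' c x := by
      refine (Finset.sum_filter_of_ne fun k _ h => ?_).symm
      exact left_ne_zero_of_mul h
    rw [h1]
    exact (Finset.sum_fiberwise_of_maps_to (fun k hk => Finset.mem_image_of_mem v hk) _).symm
  have hblock : ∀ b, ∫ x, ‖trigSum (blk b) c x‖ ^ 2 ∂μ ≤ 1031 * Q * ((9 / 10 : ℝ) ^ b) ^ 2 := by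
    intro b
    have hk1 : ∀ k ∈ blk b, k ∈ s ∧ 0 < ‖c k‖ ∧ ‖c k‖ ≤ 1 ∧ v k = b := by
      intro k hk
      simp only [hblk, hs', Finset.mem_filter] at hk
      refine ⟨hk.1.1, norm_pos_iff.2 hk.1.2, ?_, hk.2⟩
      have h1 : ‖c k‖ ^ p ≤ 1 := (Finset.single_le_sum (f := fun k => ‖c k‖ ^ p)
        (fun i _ => by positivity) hk.1.1).trans hsum
      by_contra! h2
      exact absurd h1 (not_le.2 (Real.one_lt_rpow h2 hp0))
    have hnonneg : ∀ k ∈ blk b, 0 ≤ -(η * Real.logb 2 ‖c k‖) := by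
      intro k hk
      have := Real.logb_nonpos one_lt_two (hk1 k hk).2.1.le (hk1 k hk).2.2.1
      nlinarith
    refine integral_sq_norm_trigSum_le_of_block hμ hC₁ hball hη0 hη hβ0 hβ1 hK hdecay hp _ c b
      (fun k hk => ?_) (fun k hk => ?_) ?_
    · rw [← Real.le_logb_iff_rpow_le one_lt_two (hk1 k hk).2.1]
      have h1 := Nat.lt_floor_add_one (-(η * Real.logb 2 ‖c k‖))
      rw [show ⌊-(η * Real.logb 2 ‖c k‖)⌋₊ = b from (hk1 k hk).2.2.2] at h1
      rw [neg_le, le_div_iff₀ hη0]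
      linarith
    · rw [← Real.logb_le_iff_le_rpow one_lt_two (hk1 k hk).2.1]
      have h1 := Nat.floor_le (hnonneg k hk)
      rw [show ⌊-(η * Real.logb 2 ‖c k‖)⌋₊ = b from (hk1 k hk).2.2.2] at h1
      rw [le_neg, div_le_iff₀ hη0]
      linarith
    · exact (Finset.sum_le_sum_of_subset_of_nonneg (fun k hk => (hk1 k hk).1)
        fun _ _ _ => by positivity).trans hsum
  have hint : ∀ b, Integrable (fun x => ((9 / 10 : ℝ) ^ b)⁻¹ * ‖trigSum (blk b) c x‖ ^ 2) μ := by
    intro b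
    have := integrable_sq_norm_trigSum (μ := μ) (blk b) c 0
    simp only [add_zero] at this
    exact this.const_mul _
  have hpt : ∀ x, ‖trigSum s c x‖ ^ 2 ≤
      10 * ∑ b ∈ t, ((9 / 10 : ℝ) ^ b)⁻¹ * ‖trigSum (blk b) c x‖ ^ 2 := by
    intro x
    calc ‖trigSum s c x‖ ^ 2 ≤ (∑ b ∈ t, ‖trigSum (blk b) c x‖) ^ 2 := by
          rw [hdec]; gcongr; exact norm_sum_le _ _
      _ ≤ (∑ b ∈ t, (9 / 10 : ℝ) ^ b) *
            ∑ b ∈ t, ((9 / 10 : ℝ) ^ b)⁻¹ * ‖trigSum (blk b) c x‖ ^ 2 := by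
          refine Finset.sum_sq_le_sum_mul_sum_of_sq_le_mul t (fun b _ => by positivity)
            (fun b _ => by positivity) fun b _ => le_of_eq ?_
          field_simp
      _ ≤ _ := by
          gcongr
          exact sum_pow_nine_tenths_le t
  calc ∫ x, ‖trigSum s c x‖ ^ 2 ∂μ
      ≤ ∫ x, 10 * ∑ b ∈ t, ((9 / 10 : ℝ) ^ b)⁻¹ * ‖trigSum (blk b) c x‖ ^ 2 ∂μ :=
        integral_mono_of_nonneg (ae_of_all _ fun x => by positivity)
          ((integrable_finsetSum t fun b _ => hint b).const_mul 10) (ae_of_all _ hpt)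
    _ = 10 * ∑ b ∈ t, ((9 / 10 : ℝ) ^ b)⁻¹ * ∫ x, ‖trigSum (blk b) c x‖ ^ 2 ∂μ := by
        rw [integral_const_mul, integral_finsetSum t fun b _ => hint b]
        simp_rw [integral_const_mul]
    _ ≤ 10 * ∑ b ∈ t, ((9 / 10 : ℝ) ^ b)⁻¹ * (1031 * Q * ((9 / 10 : ℝ) ^ b) ^ 2) := by
        gcongr with b _
        exact hblock b
    _ = 10 * (1031 * Q * ∑ b ∈ t, (9 / 10 : ℝ) ^ b) := by
        congr 1
        rw [Finset.mul_sum]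
        refine Finset.sum_congr rfl fun b _ => ?_
        field_simp
    _ ≤ 10 * (1031 * Q * 10) := by
        gcongr
        exact sum_pow_nine_tenths_le t
    _ = _ := by ring

/-! ### The restriction inequality for exponential sums -/

lemma one_le_of_ballCondition {μ : Measure ℝ} [IsProbabilityMeasure μ]
    (hμ : μ (Set.Icc (0 : ℝ) 1)ᶜ = 0) {α C₁ : ℝ} (hball : BallCondition μ α C₁) : 1 ≤ C₁ := by
  have h := hball 0 1 one_pos le_rfl
  rw [zero_add, Real.one_rpow, mul_one] at h
  have h1 : μ (Set.Icc (0 : ℝ) 1) = 1 := (prob_compl_eq_zero_iff measurableSet_Icc).1 hμ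
  simpa [measureReal_def, h1] using h

/-- The balanced constant `C₁^{1-u} K^u`, where `u = η / (η + β / 2)` and `K = C₂ η^{-B}`, is at
most the square of the claimed one. The factor `2 ^ (6 * B)` absorbs the powers of `η`, because
`η^{-u} ≤ η^{-3η} ≤ e³`. -/
lemma block_constant_le {η β B C₁ C₂ θ : ℝ} (hC₁ : 1 ≤ C₁) (hC₂ : 1 ≤ C₂) (hB : 0 ≤ B)
    (hη0 : 0 < η) (hβ0 : 2 / 3 < β) (hη : η < 1 / 3) (hθ : θ = 4 * η / (β + 4 * η)) :
    C₁ * (C₂ * η ^ (-B) / C₁) ^ (η / (η + β / 2)) ≤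
      (2 ^ (6 * B) * C₂ ^ θ * C₁ ^ (1 - θ)) ^ 2 := by
  set u := η / (η + β / 2) with hu
  have hu0 : 0 < u := by positivity
  have hu3 : u ≤ 3 * η := by
    rw [hu, div_le_iff₀ (by positivity)]; nlinarith
  have huθ : u ≤ θ * 2 := by
    rw [hu, hθ, div_mul_eq_mul_div, div_le_div_iff₀ (by positivity) (by positivity)]; nlinarith
  have hu1 : 1 - u ≤ (1 - θ) * 2 := by
    have h1 : 1 - u = β / (2 * η + β) := by rw [hu]; field_simp; ring
    have h2 : (1 - θ) * 2 = 2 * β / (β + 4 * η) := by rw [hθ]; field_simp; ring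
    rw [h1, h2, div_le_div_iff₀ (by positivity) (by positivity)]; nlinarith
  have hη_u : η ^ (-u) ≤ 2 ^ (12 : ℝ) := by
    have h1 : -Real.log η ≤ η⁻¹ - 1 := by
      have := Real.one_sub_inv_le_log_of_pos hη0; linarith
    have h2 : Real.log η * -u ≤ 3 := by
      have h3 : 0 ≤ -Real.log η := by
        have := Real.log_nonpos hη0.le (by linarith); linarith
      calc Real.log η * -u = -Real.log η * u := by ring
        _ ≤ -Real.log η * (3 * η) := by gcongr
        _ ≤ (η⁻¹ - 1) * (3 * η) := by gcongr
        _ = 3 - 3 * η := by field_simp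
        _ ≤ 3 := by linarith
    calc η ^ (-u) = Real.exp (Real.log η * -u) := Real.rpow_def_of_pos hη0 _
      _ ≤ Real.exp 3 := Real.exp_le_exp.2 h2
      _ = Real.exp 1 ^ 3 := by rw [← Real.exp_nat_mul]; norm_num
      _ ≤ 3 ^ 3 := by
          have := Real.exp_one_lt_d9
          gcongr; linarith
      _ ≤ 2 ^ (12 : ℝ) := by norm_num
  have hL : C₁ * (C₂ * η ^ (-B) / C₁) ^ u = (η ^ (-u)) ^ B * C₂ ^ u * C₁ ^ (1 - u) := by
    rw [Real.div_rpow (by positivity) (by positivity), Real.mul_rpow (by positivity)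
      (by positivity), Real.rpow_sub (by positivity), Real.rpow_one, ← Real.rpow_mul hη0.le,
      ← Real.rpow_mul hη0.le, show -B * u = -u * B by ring]
    ring
  have hR : (2 ^ (6 * B) * C₂ ^ θ * C₁ ^ (1 - θ)) ^ 2 =
      ((2 : ℝ) ^ (12 : ℝ)) ^ B * C₂ ^ (θ * 2) * C₁ ^ ((1 - θ) * 2) := by
    have h1 : ((2 : ℝ) ^ (6 * B)) ^ 2 = ((2 : ℝ) ^ (12 : ℝ)) ^ B := by
      rw [← Real.rpow_two, ← Real.rpow_mul zero_le_two, ← Real.rpow_mul zero_le_two]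
      ring_nf
    rw [mul_pow, mul_pow, h1, Real.rpow_mul (by positivity) θ 2,
      Real.rpow_mul (by positivity) (1 - θ) 2, Real.rpow_two, Real.rpow_two]
  rw [hL, hR]
  gcongr

/-- The restriction inequality for finite exponential sums. -/
lemma integral_sq_norm_trigSum_le {α β B C₁ C₂ p θ : ℝ} {μ : Measure ℝ} [IsProbabilityMeasure μ]
    (hα0 : 2 / 3 < α) (hα1 : α ≤ 1) (hβ0 : 2 / 3 < β) (hβ1 : β ≤ 1) (hB : 0 ≤ B) (hC₂ : 1 ≤ C₂)
    (hμ : μ (Set.Icc (0 : ℝ) 1)ᶜ = 0) (hball : BallCondition μ α C₁)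
    (hdecay : FourierDecay μ α β B C₂)
    (hp : p = 2 * (β + 4 * (1 - α)) / (β + 8 * (1 - α))) (hθ : θ = 2 / p - 1)
    (s : Finset ℤ) (c : ℤ → ℂ) :
    ∫ x, ‖trigSum s c x‖ ^ 2 ∂μ ≤
      (2 ^ (6 * B) * 330 * C₂ ^ θ * C₁ ^ (1 - θ) * (∑ k ∈ s, ‖c k‖ ^ p) ^ (1 / p)) ^ 2 := by
  have hC₁ := one_le_of_ballCondition hμ hball
  rcases eq_or_lt_of_le hα1 with rfl | hα
  · have hp2 : p = 2 := by rw [hp]; field_simp; ring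
    have hθ0 : θ = 0 := by rw [hθ, hp2]; norm_num
    have h := integral_sq_norm_trigSum_le_of_ball_one hμ hball s c
    have h1 : (1 : ℝ) ≤ 2 ^ (6 * B) := Real.one_le_rpow one_le_two (by positivity)
    have h2 : (0 : ℝ) ≤ ∑ k ∈ s, ‖c k‖ ^ 2 := by positivity
    rw [hθ0, hp2, mul_pow, ← Real.sqrt_eq_rpow]
    simp only [Real.rpow_two, Real.rpow_zero, sub_zero, Real.rpow_one, mul_one]
    rw [Real.sq_sqrt h2]
    refine h.trans ?_
    gcongr
    have h3 : (1 * 330 * C₁) ^ 2 ≤ (2 ^ (6 * B) * 330 * C₁) ^ 2 := by gcongr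
    nlinarith
  set η := 1 - α with hη
  have hη0 : 0 < η := by linarith
  have hη1 : η < 1 / 3 := by linarith
  have hp0 : 0 < p := by rw [hp]; positivity
  have hθ' : θ = 4 * η / (β + 4 * η) := by
    rw [hθ, hp]; field_simp; ring
  have hK : 1 ≤ C₂ * η ^ (-B) := by
    have : 1 ≤ η ^ (-B) :=
      Real.one_le_rpow_of_pos_of_le_one_of_nonpos hη0 (by linarith) (by linarith)
    nlinarith
  have hdecay' : ∀ k : ℤ, k ≠ 0 →
      ‖measureFourierCoeff μ k‖ ≤ C₂ * η ^ (-B) * |(k : ℝ)| ^ (-(β / 2)) := by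
    intro k hk
    have h := hdecay k hk
    have hpos : 0 < η ^ B := Real.rpow_pos_of_pos hη0 B
    rw [Real.rpow_neg hη0.le, mul_right_comm, ← div_eq_mul_inv, le_div_iff₀ hpos, mul_comm]
    exact h
  have hball' : BallCondition μ (1 - η) C₁ := by rwa [hη, sub_sub_cancel]
  set P := (∑ k ∈ s, ‖c k‖ ^ p) ^ (1 / p) with hP
  have hsum0 : 0 ≤ ∑ k ∈ s, ‖c k‖ ^ p := by positivity
  have hP0 : 0 ≤ P := by positivity
  have hPp : P ^ p = ∑ k ∈ s, ‖c k‖ ^ p := by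
    rw [hP, ← Real.rpow_mul hsum0, one_div_mul_cancel hp0.ne', Real.rpow_one]
  rcases hP0.eq_or_lt with h0 | hPpos
  · rw [← h0, Real.zero_rpow hp0.ne'] at hPp
    have hz : ∀ k ∈ s, c k = 0 := by
      intro k hk
      have := (Finset.sum_eq_zero_iff_of_nonneg fun i _ => by positivity).1 hPp.symm k hk
      rwa [Real.rpow_eq_zero (norm_nonneg _) hp0.ne', norm_eq_zero] at this
    have : ∀ x, trigSum s c x = 0 := fun x => Finset.sum_eq_zero fun k hk => by simp [hz k hk]
    simp only [this]
    simp
    positivity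
  · have hscale : ∀ x, trigSum s c x = P * trigSum s (fun k => c k / P) x := by
      intro x
      have hPne : (P : ℂ) ≠ 0 := Complex.ofReal_ne_zero.2 hPpos.ne'
      rw [trigSum, trigSum, Finset.mul_sum]
      refine Finset.sum_congr rfl fun k _ => ?_
      field_simp
    have hnorm : ∑ k ∈ s, ‖c k / P‖ ^ p ≤ 1 := by
      have : ∀ k, ‖c k / P‖ ^ p = ‖c k‖ ^ p / P ^ p := by
        intro k
        rw [norm_div, Complex.norm_real, Real.norm_of_nonneg hP0,
          Real.div_rpow (norm_nonneg _) hP0]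
      simp_rw [this]
      rw [← Finset.sum_div, ← hPp, div_self (Real.rpow_pos_of_pos hPpos p).ne']
    have h := integral_sq_norm_trigSum_le_of_sum_le_one hμ hC₁ hball' hη0 hη1 hβ0 hβ1 hK hdecay' hp
      s _ hnorm
    have hconst := block_constant_le hC₁ hC₂ hB hη0 hβ0 hη1 hθ'
    simp_rw [hscale, norm_mul, Complex.norm_real, Real.norm_of_nonneg hP0, mul_pow]
    rw [integral_const_mul]
    have h3 : ∫ x, ‖trigSum s (fun k => c k / P) x‖ ^ 2 ∂μ ≤
        330 ^ 2 * (2 ^ (6 * B) * C₂ ^ θ * C₁ ^ (1 - θ)) ^ 2 := by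
      refine h.trans ?_
      gcongr
      norm_num
    calc _ ≤ P ^ 2 * (330 ^ 2 * (2 ^ (6 * B) * C₂ ^ θ * C₁ ^ (1 - θ)) ^ 2) := by gcongr
      _ = _ := by ring

/-! ### Extension to infinite series -/

lemma memLp_trigSum {μ : Measure ℝ} [IsFiniteMeasure μ] (s : Finset ℤ) (c : ℤ → ℂ) :
    MemLp (trigSum s c) 2 μ :=
  MemLp.of_bound (continuous_trigSum s c).aestronglyMeasurable (∑ k ∈ s, ‖c k‖)
    (ae_of_all _ (norm_trigSum_le s c))

lemma eLpNorm_two_eq_ofReal {μ : Measure ℝ} {f : ℝ → ℂ} (hf : MemLp f 2 μ) :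
    eLpNorm f 2 μ = ENNReal.ofReal ((∫ x, ‖f x‖ ^ 2 ∂μ) ^ (1 / 2 : ℝ)) := by
  rw [hf.eLpNorm_eq_integral_rpow_norm two_ne_zero ENNReal.ofNat_ne_top]
  simp

lemma eLpNorm_trigSum_le {μ : Measure ℝ} [IsFiniteMeasure μ] {s : Finset ℤ} {c : ℤ → ℂ} {R : ℝ}
    (hR : 0 ≤ R) (h : ∫ x, ‖trigSum s c x‖ ^ 2 ∂μ ≤ R ^ 2) :
    eLpNorm (trigSum s c) 2 μ ≤ ENNReal.ofReal R := by
  rw [eLpNorm_two_eq_ofReal (memLp_trigSum s c), ← Real.sqrt_eq_rpow]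
  exact ENNReal.ofReal_le_ofReal (Real.sqrt_le_iff.2 ⟨hR, h⟩)

/-- An `ℓ^p → L²(μ)` bound for exponential sums with uniform constant makes every series with
coefficients in `ℓ^p` converge unconditionally in `L²(μ)`, with the same bound for its sum. -/
lemma exists_memLp_tendsto_trigSum {μ : Measure ℝ} [IsFiniteMeasure μ] {K p : ℝ} (hK : 0 ≤ K)
    (hp : 0 < p)
    (hbound : ∀ (s : Finset ℤ) (c : ℤ → ℂ),
      ∫ x, ‖trigSum s c x‖ ^ 2 ∂μ ≤ (K * (∑ k ∈ s, ‖c k‖ ^ p) ^ (1 / p)) ^ 2)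
    {c : ℤ → ℂ} (hc : Summable fun k => ‖c k‖ ^ p) :
    ∃ F : ℝ → ℂ, MemLp F 2 μ ∧
      Tendsto (fun s : Finset ℤ => eLpNorm (fun x => F x - trigSum s c x) 2 μ) atTop (𝓝 0) ∧
      (∫ x, ‖F x‖ ^ 2 ∂μ) ^ (1 / 2 : ℝ) ≤ K * ellNorm p c := by
  have hterm : ∀ k, MemLp (fun x => c k * planeWave k x) 2 μ := fun k =>
    MemLp.of_bound (continuous_const.mul (continuous_planeWave k)).aestronglyMeasurable ‖c k‖
      (ae_of_all _ fun x => by simp)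
  set u : ℤ → Lp ℂ 2 μ := fun k => (hterm k).toLp with hu
  have hcoe : ∀ s : Finset ℤ, ⇑(∑ k ∈ s, u k) =ᵐ[μ] trigSum s c := by
    intro s
    have h1 : ∑ k ∈ s, u k = (memLp_trigSum (μ := μ) s c).toLp := by
      have h2 : trigSum s c = ∑ k ∈ s, fun x => c k * planeWave k x := by
        ext x; simp [trigSum]
      apply Lp.ext
      refine (Lp.coeFn_finsetSum s u).trans (EventuallyEq.trans ?_ (MemLp.coeFn_toLp _).symm)
      rw [h2]
      have h3 : ∀ᵐ x ∂μ, ∀ k : ℤ, u k x = c k * planeWave k x :=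
        ae_all_iff.2 fun k => (hterm k).coeFn_toLp
      filter_upwards [h3] with x hx
      simp [hx]
    rw [h1]
    exact MemLp.coeFn_toLp _
  have hnorm : ∀ s : Finset ℤ, ‖∑ k ∈ s, u k‖ ≤ K * (∑ k ∈ s, ‖c k‖ ^ p) ^ (1 / p) := by
    intro s
    rw [Lp.norm_def, eLpNorm_congr_ae (hcoe s)]
    exact ENNReal.toReal_le_of_le_ofReal (by positivity)
      (eLpNorm_trigSum_le (by positivity) (hbound s c))
  have hsum : Summable u := by
    rw [summable_iff_vanishing_norm]
    intro ε hε
    obtain ⟨s, hs⟩ := summable_iff_vanishing_norm.1 hc ((ε / (K + 1)) ^ p) (by positivity)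
    refine ⟨s, fun t ht => (hnorm t).trans_lt ?_⟩
    have h1 := hs t ht
    have h0 : 0 ≤ ∑ k ∈ t, ‖c k‖ ^ p := by positivity
    rw [Real.norm_of_nonneg h0] at h1
    have h2 : (∑ k ∈ t, ‖c k‖ ^ p) ^ (1 / p) ≤ ε / (K + 1) := by
      calc (∑ k ∈ t, ‖c k‖ ^ p) ^ (1 / p) ≤ ((ε / (K + 1)) ^ p) ^ (1 / p) := by gcongr
        _ = ε / (K + 1) := by
          rw [← Real.rpow_mul (by positivity), mul_one_div_cancel hp.ne', Real.rpow_one]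
    calc K * (∑ k ∈ t, ‖c k‖ ^ p) ^ (1 / p) ≤ K * (ε / (K + 1)) := by gcongr
      _ < ε := by
        rw [mul_div_assoc', div_lt_iff₀ (by positivity)]; nlinarith
  refine ⟨⇑(∑' k, u k), Lp.memLp _, ?_, ?_⟩
  · have h1 := (Lp.tendsto_Lp_iff_tendsto_eLpNorm' _ _).1 hsum.hasSum
    refine h1.congr fun s => ?_
    rw [eLpNorm_sub_comm]
    refine eLpNorm_congr_ae ?_
    filter_upwards [hcoe s] with x hx
    rw [Pi.sub_apply, hx]
  · have h1 : ‖∑' k, u k‖ ≤ K * ellNorm p c := by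
      refine le_of_tendsto hsum.hasSum.norm (Eventually.of_forall fun s => (hnorm s).trans ?_)
      unfold ellNorm
      gcongr
      exact hc.sum_le_tsum s fun k _ => by positivity
    rwa [Lp.norm_def, eLpNorm_two_eq_ofReal (Lp.memLp _),
      ENNReal.toReal_ofReal (by positivity)] at h1

/-! ### Recovering a continuous function from its Fourier coefficients -/

/-- Parseval's identity for two functions on the unit interval. -/
lemma hasSum_conj_fourierCoeffOn_mul {f g : ℝ → ℂ}
    (hf : MemLp f 2 (volume.restrict (Set.Ioc 0 1)))
    (hg : MemLp g 2 (volume.restrict (Set.Ioc 0 1))) :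
    HasSum (fun k => (starRingEnd ℂ) (fourierCoeffOn (zero_lt_one' ℝ) g k) *
      fourierCoeffOn (zero_lt_one' ℝ) f k) (∫ x in (0 : ℝ)..1, (starRingEnd ℂ) (g x) * f x) := by
  have : Fact ((0 : ℝ) < 1 - 0) := ⟨by norm_num⟩
  have h01 : (0 : ℝ) + (1 - 0) = 1 := by norm_num
  rw [← h01] at hf hg
  have hF := hf.memLp_liftIoc.haarAddCircle
  have hG := hg.memLp_liftIoc.haarAddCircle
  have h := fourierBasis.hasSum_inner_mul_inner hG.toLp hF.toLp
  have e1 : (fun k => inner ℂ hG.toLp (fourierBasis k) * inner ℂ (fourierBasis k) hF.toLp) =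
      fun k => (starRingEnd ℂ) (fourierCoeffOn (zero_lt_one' ℝ) g k) *
        fourierCoeffOn (zero_lt_one' ℝ) f k := by
    ext k
    rw [← inner_conj_symm, ← HilbertBasis.repr_apply_apply, ← HilbertBasis.repr_apply_apply,
      fourierBasis_repr, fourierBasis_repr, fourierCoeff_congr_ae hF.coeFn_toLp,
      fourierCoeff_congr_ae hG.coeFn_toLp]
    rfl
  have e2 : inner ℂ hG.toLp hF.toLp = ∫ x in (0 : ℝ)..1, (starRingEnd ℂ) (g x) * f x := by
    rw [L2.inner_def]
    have h1 : ∀ᵐ x ∂(AddCircle.haarAddCircle (T := (1 : ℝ) - 0)),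
        inner ℂ (hG.toLp _ x) (hF.toLp _ x) =
          AddCircle.liftIoc ((1 : ℝ) - 0) 0 (fun x => (starRingEnd ℂ) (g x) * f x) x := by
      filter_upwards [hF.coeFn_toLp, hG.coeFn_toLp] with x hx hy
      rw [hx, hy, RCLike.inner_apply, mul_comm]
      rfl
    rw [integral_congr_ae h1, AddCircle.integral_haarAddCircle,
      AddCircle.integral_liftIoc_eq_intervalIntegral, h01]
    simp
  rw [e1, e2] at h
  exact h

/-- A continuous function may be integrated over an interval term by term in its Fourier series. -/
lemma hasSum_fourierCoeffOn_mul_integral {f : ℝ → ℂ} (hf : Continuous f) {x y : ℝ} (hx : 0 ≤ x)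
    (hxy : x ≤ y) (hy : y ≤ 1) :
    HasSum (fun k => fourierCoeffOn (zero_lt_one' ℝ) f k * ∫ t in x..y, planeWave k t)
      (∫ t in x..y, f t) := by
  have hfm : MemLp f 2 (volume.restrict (Set.Ioc 0 1)) := by
    obtain ⟨C, hC⟩ := isCompact_Icc.exists_bound_of_continuousOn
      (hf.continuousOn (s := Set.Icc (0 : ℝ) 1))
    exact MemLp.of_bound hf.aestronglyMeasurable C
      ((ae_restrict_mem measurableSet_Ioc).mono fun t ht => hC t (Set.Ioc_subset_Icc_self ht))
  have hgm : MemLp ((Set.Ioc x y).indicator fun _ => (1 : ℂ)) 2 (volume.restrict (Set.Ioc 0 1)) :=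
    (memLp_const 1).indicator measurableSet_Ioc
  have hsub : Set.Ioc x y ⊆ Set.Ioc 0 1 := Set.Ioc_subset_Ioc hx hy
  have hind : ∀ F : ℝ → ℂ, ∫ t in (0 : ℝ)..1, (Set.Ioc x y).indicator F t = ∫ t in x..y, F t := by
    intro F
    rw [intervalIntegral.integral_of_le zero_le_one, intervalIntegral.integral_of_le hxy,
      setIntegral_indicator measurableSet_Ioc, Set.inter_eq_right.2 hsub]
  convert hasSum_conj_fourierCoeffOn_mul hfm hgm using 1
  · ext k
    rw [mul_comm]
    congr 1
    rw [fourierCoeffOn_eq_integral]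
    simp only [fourier_coe_apply]
    rw [← hind, sub_zero, div_one, one_smul, intervalIntegral.integral_of_le zero_le_one,
      intervalIntegral.integral_of_le zero_le_one, ← integral_conj]
    refine integral_congr_ae (ae_of_all _ fun t => ?_)
    by_cases ht : t ∈ Set.Ioc x y
    · simp only [Set.indicator_of_mem ht, smul_eq_mul, mul_one]
      rw [← neg_neg k, ← conj_planeWave, neg_neg]
      simp [planeWave]
    · simp [Set.indicator_of_notMem ht]
  · rw [← hind]
    refine intervalIntegral.integral_congr fun t _ => ?_
    by_cases ht : t ∈ Set.Ioc x y
    · simp [Set.indicator_of_mem ht]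
    · simp [Set.indicator_of_notMem ht]

/-- The `L²(μ)` bound for the averages of a continuous function over `[x, x + h]`. Averaging
multiplies the `k`-th Fourier coefficient by a number of modulus at most `1`. -/
lemma eLpNorm_average_le {μ : Measure ℝ} [IsFiniteMeasure μ] {K p : ℝ} (hK : 0 ≤ K)
    (hp : 0 < p)
    (hbound : ∀ (s : Finset ℤ) (c : ℤ → ℂ),
      ∫ x, ‖trigSum s c x‖ ^ 2 ∂μ ≤ (K * (∑ k ∈ s, ‖c k‖ ^ p) ^ (1 / p)) ^ 2)
    {f : ℝ → ℂ} (hf : Continuous f)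
    (hc : Summable fun k => ‖fourierCoeffOn (zero_lt_one' ℝ) f k‖ ^ p) {h : ℝ} (hh : 0 < h) :
    eLpNorm ((Set.Icc 0 (1 - h)).indicator fun x => (h : ℂ)⁻¹ * ∫ t in x..x + h, f t) 2 μ ≤
      ENNReal.ofReal (K * ellNorm p fun k => fourierCoeffOn (zero_lt_one' ℝ) f k) := by
  set a : ℤ → ℂ := fun k => fourierCoeffOn (zero_lt_one' ℝ) f k with ha
  set d : ℤ → ℂ := fun k => a k * ((h : ℂ)⁻¹ * ∫ t in (0 : ℝ)..h, planeWave k t) with hd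
  have hda : ∀ k, ‖d k‖ ≤ ‖a k‖ := by
    intro k
    have h1 : ‖∫ t in (0 : ℝ)..h, planeWave k t‖ ≤ 1 * |h - 0| :=
      intervalIntegral.norm_integral_le_of_norm_le_const fun t _ => (norm_planeWave k t).le
    rw [sub_zero, one_mul, abs_of_pos hh] at h1
    rw [hd, norm_mul]
    refine mul_le_of_le_one_right (norm_nonneg _) ?_
    rw [norm_mul, norm_inv, Complex.norm_real, Real.norm_of_nonneg hh.le, inv_mul_le_iff₀ hh,
      mul_one]
    exact h1
  have hlim : ∀ x, Tendsto (fun n : ℕ => (Set.Icc 0 (1 - h)).indicator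
      (trigSum (Finset.Icc (-(n : ℤ)) n) d) x) atTop
      (𝓝 ((Set.Icc 0 (1 - h)).indicator (fun x => (h : ℂ)⁻¹ * ∫ t in x..x + h, f t) x)) := by
    intro x
    by_cases hx : x ∈ Set.Icc 0 (1 - h)
    · simp only [Set.indicator_of_mem hx]
      have h1 := (hasSum_fourierCoeffOn_mul_integral hf hx.1 (y := x + h) (by linarith)
        (by linarith [hx.2])).mul_left (h : ℂ)⁻¹
      have h2 : (fun k => (h : ℂ)⁻¹ * (fourierCoeffOn (zero_lt_one' ℝ) f k *
          ∫ t in x..x + h, planeWave k t)) = fun k => d k * planeWave k x := by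
        ext k
        have h3 : ∫ t in x..x + h, planeWave k t =
            planeWave k x * ∫ t in (0 : ℝ)..h, planeWave k t := by
          rw [← intervalIntegral.integral_const_mul]
          simp_rw [← planeWave_add]
          rw [intervalIntegral.integral_comp_add_left, add_zero]
        simp only [h3, hd, ha]
        ring
      rw [h2] at h1
      exact h1.comp Finset.tendsto_Icc_neg
    · simp only [Set.indicator_of_notMem hx]
      exact tendsto_const_nhds
  refine (Lp.eLpNorm_lim_le_liminf_eLpNorm (fun n => ((continuous_trigSum _
    d).aestronglyMeasurable.indicator measurableSet_Icc)) _ (ae_of_all _ hlim)).trans ?_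
  refine liminf_le_of_frequently_le' (Frequently.of_forall fun n => ?_)
  refine (eLpNorm_indicator_le _).trans ?_
  refine (eLpNorm_trigSum_le (by positivity) (hbound _ d)).trans (ENNReal.ofReal_le_ofReal ?_)
  unfold ellNorm
  gcongr
  calc ∑ k ∈ Finset.Icc (-(n : ℤ)) n, ‖d k‖ ^ p ≤ ∑ k ∈ Finset.Icc (-(n : ℤ)) n, ‖a k‖ ^ p := by
        gcongr with k _
        exact hda k
    _ ≤ _ := hc.sum_le_tsum _ fun k _ => by positivity

/-- The bound for a continuous function follows from that for its averages by Fatou's lemma. The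
endpoint `1` has to be a null set, as the periodic extension of `f` need not be continuous. -/
lemma integral_sq_norm_le_of_continuous {μ : Measure ℝ} [IsFiniteMeasure μ]
    (hμ : μ (Set.Icc (0 : ℝ) 1)ᶜ = 0) (hμ1 : μ {1} = 0) {K p : ℝ} (hK : 0 ≤ K) (hp : 0 < p)
    (hbound : ∀ (s : Finset ℤ) (c : ℤ → ℂ),
      ∫ x, ‖trigSum s c x‖ ^ 2 ∂μ ≤ (K * (∑ k ∈ s, ‖c k‖ ^ p) ^ (1 / p)) ^ 2)
    {f : ℝ → ℂ} (hf : Continuous f)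
    (hc : Summable fun k => ‖fourierCoeffOn (zero_lt_one' ℝ) f k‖ ^ p) :
    (∫ x, ‖f x‖ ^ 2 ∂μ) ^ (1 / 2 : ℝ) ≤
      K * ellNorm p fun k => fourierCoeffOn (zero_lt_one' ℝ) f k := by
  have hell : 0 ≤ ellNorm p fun k => fourierCoeffOn (zero_lt_one' ℝ) f k := by
    unfold ellNorm
    exact Real.rpow_nonneg (tsum_nonneg fun k => by positivity) _
  have hseq : ∀ n : ℕ, (0 : ℝ) < 1 / ((n : ℝ) + 1) := fun n => by positivity
  have hseq0 : Tendsto (fun n : ℕ => 1 / ((n : ℝ) + 1)) atTop (𝓝 0) :=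
    tendsto_one_div_add_atTop_nhds_zero_nat
  have hcontP : Continuous fun x => ∫ t in (0 : ℝ)..x, f t :=
    intervalIntegral.continuous_primitive (fun _ _ => hf.intervalIntegrable _ _) 0
  have hdiff : ∀ x h : ℝ, ∫ t in x..x + h, f t =
      (∫ t in (0 : ℝ)..x + h, f t) - ∫ t in (0 : ℝ)..x, f t := fun x h =>
    (intervalIntegral.integral_interval_sub_left (hf.intervalIntegrable _ _)
      (hf.intervalIntegrable _ _)).symm
  set G : ℝ → ℝ → ℂ := fun h =>
    (Set.Icc 0 (1 - h)).indicator fun x => (h : ℂ)⁻¹ * ∫ t in x..x + h, f t with hG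
  have hmeas : ∀ h : ℝ, AEStronglyMeasurable (G h) μ := by
    intro h
    refine AEStronglyMeasurable.indicator (Continuous.aestronglyMeasurable ?_) measurableSet_Icc
    simp_rw [hdiff]
    exact continuous_const.mul ((hcontP.comp (continuous_id.add continuous_const)).sub hcontP)
  have hae : ∀ᵐ x ∂μ, Tendsto (fun n : ℕ => G (1 / ((n : ℝ) + 1)) x) atTop (𝓝 (f x)) := by
    have h1 : ∀ᵐ x ∂μ, x ∈ Set.Icc (0 : ℝ) 1 := hμ
    have h2 : ∀ᵐ x ∂μ, x ≠ 1 := by simpa [ae_iff] using hμ1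
    filter_upwards [h1, h2] with x hx hx1
    have hx1' : 0 < 1 - x := sub_pos.2 (lt_of_le_of_ne hx.2 hx1)
    have hder := hasDerivAt_iff_tendsto_slope_zero.1
      (hf.integral_hasStrictDerivAt 0 x).hasDerivAt
    have hto : Tendsto (fun n : ℕ => 1 / ((n : ℝ) + 1)) atTop (𝓝[≠] 0) :=
      tendsto_nhdsWithin_iff.2 ⟨hseq0, Eventually.of_forall fun n => (hseq n).ne'⟩
    refine (hder.comp hto).congr' ?_
    filter_upwards [hseq0.eventually (ge_mem_nhds hx1')] with n hn
    have hmem : x ∈ Set.Icc 0 (1 - 1 / ((n : ℝ) + 1)) := ⟨hx.1, by linarith⟩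
    simp only [hG, Set.indicator_of_mem hmem, Function.comp_apply]
    rw [hdiff, Complex.real_smul, Complex.ofReal_inv]
  have hle : eLpNorm f 2 μ ≤
      ENNReal.ofReal (K * ellNorm p fun k => fourierCoeffOn (zero_lt_one' ℝ) f k) := by
    refine (Lp.eLpNorm_lim_le_liminf_eLpNorm (f := fun n : ℕ => G (1 / ((n : ℝ) + 1)))
      (fun n => hmeas _) f hae).trans ?_
    exact liminf_le_of_frequently_le' (Frequently.of_forall fun n =>
      eLpNorm_average_le hK hp hbound hf hc (hseq n))
  have hfm : MemLp f 2 μ := ⟨hf.aestronglyMeasurable, hle.trans_lt ENNReal.ofReal_lt_top⟩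
  rw [eLpNorm_two_eq_ofReal hfm] at hle
  exact (ENNReal.ofReal_le_ofReal_iff (by positivity)).1 hle

lemma measure_singleton_eq_zero_of_ballCondition {μ : Measure ℝ} [IsFiniteMeasure μ] {α C₁ : ℝ}
    (hα : 0 < α) (hball : BallCondition μ α C₁) (x : ℝ) : μ {x} = 0 := by
  have h1 : ∀ ε : ℝ, 0 < ε → ε ≤ 1 → μ.real {x} ≤ C₁ * ε ^ α := fun ε h0 h1 =>
    (measureReal_mono (by simp [h0.le])).trans (hball x ε h0 h1)
  have h2 : Tendsto (fun ε : ℝ => C₁ * ε ^ α) (𝓝[>] 0) (𝓝 0) := by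
    have h3 : Tendsto (fun ε : ℝ => C₁ * ε ^ α) (𝓝 0) (𝓝 (C₁ * 0 ^ α)) :=
      ((Real.continuousAt_rpow_const 0 α (Or.inr hα.le)).tendsto).const_mul C₁
    rw [Real.zero_rpow hα.ne', mul_zero] at h3
    exact h3.mono_left nhdsWithin_le_nhds
  have h4 : μ.real {x} ≤ 0 := by
    refine ge_of_tendsto h2 ?_
    filter_upwards [Ioc_mem_nhdsGT (zero_lt_one' ℝ)] with ε hε using h1 ε hε.1 hε.2
  exact (measureReal_eq_zero_iff).1 (le_antisymm h4 measureReal_nonneg)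

theorem proposition4 :
    ∃ A : ℝ, 0 < A ∧
      ∀ (α β B C₁ C₂ p θ : ℝ) (μ : Measure ℝ) [IsProbabilityMeasure μ],
        2 / 3 < α → α ≤ 1 → 2 / 3 < β → β ≤ 1 → 0 ≤ B → 1 ≤ C₂ →
        μ (Set.Icc (0 : ℝ) 1)ᶜ = 0 →
        BallCondition μ α C₁ →
        FourierDecay μ α β B C₂ →
        p = 2 * (β + 4 * (1 - α)) / (β + 8 * (1 - α)) →
        θ = 2 / p - 1 →
        -- the estimate for continuous functions on the unit interval
        (∀ f : ℝ → ℂ, ContinuousOn f (Set.Icc 0 1) →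
          Summable (fun k : ℤ => ‖fourierCoeffOn (zero_lt_one' ℝ) f k‖ ^ p) →
          (∫ x, ‖f x‖ ^ 2 ∂μ) ^ (1 / 2 : ℝ) ≤
            2 ^ (6 * B) * A * C₂ ^ θ * C₁ ^ (1 - θ) *
              ellNorm p (fun k => fourierCoeffOn (zero_lt_one' ℝ) f k)) ∧
        -- the estimate for all Fourier series with coefficients in `ℓ^p`, summed in `L²(μ)`
        (∀ c : ℤ → ℂ, Summable (fun k : ℤ => ‖c k‖ ^ p) →
          ∃ F : ℝ → ℂ, MemLp F 2 μ ∧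
            Tendsto (fun s : Finset ℤ =>
              eLpNorm (fun x => F x -
                ∑ k ∈ s, c k * Complex.exp (2 * Real.pi * Complex.I * k * x)) 2 μ)
              atTop (𝓝 0) ∧
            (∫ x, ‖F x‖ ^ 2 ∂μ) ^ (1 / 2 : ℝ) ≤
              2 ^ (6 * B) * A * C₂ ^ θ * C₁ ^ (1 - θ) * ellNorm p c) := by
  refine ⟨330, by norm_num, ?_⟩
  intro α β B C₁ C₂ p θ μ _ hα0 hα1 hβ0 hβ1 hB hC₂ hμ hball hdecay hp hθ
  have hC₁ := one_le_of_ballCondition hμ hball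
  have hη : 0 ≤ 1 - α := sub_nonneg.2 hα1
  have hp0 : 0 < p := by rw [hp]; positivity
  have hK : 0 ≤ 2 ^ (6 * B) * 330 * C₂ ^ θ * C₁ ^ (1 - θ) := by positivity
  have hbound := fun (s : Finset ℤ) (c : ℤ → ℂ) =>
    integral_sq_norm_trigSum_le hα0 hα1 hβ0 hβ1 hB hC₂ hμ hball hdecay hp hθ s c
  refine ⟨fun f hf hc => ?_, fun c hc => ?_⟩
  · -- `f` matters only on the unit interval, so it may be replaced by a continuous extension.
    set g : ℝ → ℂ := Set.IccExtend (zero_le_one' ℝ) (Set.domRestrict (Set.Icc 0 1) f) with hg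
    have hgc : Continuous g := (continuousOn_iff_continuous_domRestrict.1 hf).Icc_extend'
    have hgf : ∀ x ∈ Set.Icc (0 : ℝ) 1, g x = f x := fun x hx => Set.IccExtend_of_mem _ _ hx
    have hcoef : ∀ k, fourierCoeffOn (zero_lt_one' ℝ) g k =
        fourierCoeffOn (zero_lt_one' ℝ) f k := by
      intro k
      rw [fourierCoeffOn_eq_integral, fourierCoeffOn_eq_integral]
      congr 1
      refine intervalIntegral.integral_congr fun x hx => ?_
      rw [Set.uIcc_of_le zero_le_one] at hx
      simp only [hgf x hx]
    have hint : ∫ x, ‖g x‖ ^ 2 ∂μ = ∫ x, ‖f x‖ ^ 2 ∂μ := by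
      refine integral_congr_ae ?_
      have h1 : ∀ᵐ x ∂μ, x ∈ Set.Icc (0 : ℝ) 1 := hμ
      filter_upwards [h1] with x hx
      rw [hgf x hx]
    have h := integral_sq_norm_le_of_continuous hμ
      (measure_singleton_eq_zero_of_ballCondition (by linarith) hball 1) hK hp0 hbound hgc
      (by simpa only [hcoef] using hc)
    simpa only [hcoef, hint] using h
  · exact exists_memLp_tendsto_trigSum hK hp0 hbound hc
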